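/- Let $\Omega\subset\mathbb R^3$ be a simply connected region, i.e. a nonempty open (path-)connected set with trivial fundamental group. Let $g_{ij}=\delta_{ij}$ be the Euclidean metric in Cartesian coordinates, $D_i=D^i=\partial_i$, $\Delta=D^nD_n$, let $\epsilon_{ijk}$ be the totally antisymmetric symbol with $\epsilon_{123}=1$, let round brackets denote symmetrisation, $a_{(ij)}=\frac12(a_{ij}+a_{ji})$, and sum over repeated indices. For a 2-tensor field $u_{ij}$ put $$P(u)_{m\ell}=\frac12\,\epsilon_m{}^{ij}\,\partial_i\Big(\Delta u_{j\ell}-2\,\partial_{(\ell}D^n u_{j)n}+\frac12\, g_{j\ell}\,D^nD^k u_{nk}\Big).$$ Let $3\le k\le\infty$, and let $u_{ij}$ be a symmetric, trace-free tensor field of class $C^k$ on $\Omega$ with $P(u)=0$ on $\Omega$. Then there is a covector field $\lambda_i$ of class $C^{k+1}$ on $\Omega$ (smooth if $k=\infty$) such that $$u_{ij}=D_i\lambda_j+D_j\lambda_i-\frac23\,D^k\lambda_k\,g_{ij}\qquad\text{on }\Omega ;$$ that is, $u$ lies in the image of the conformal Killing operator. -/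

import Mathlib

/-- Euclidean three-space with its Cartesian coordinates. -/
abbrev E3 : Type := EuclideanSpace ℝ (Fin 3)

/-- The partial derivative `∂ᵢ f` in Cartesian coordinates. This is also the covariant derivative
`Dᵢ = Dⁱ` of the Euclidean metric acting on Cartesian components. -/
noncomputable def pd (i : Fin 3) (f : E3 → ℝ) (x : E3) : ℝ :=
  fderiv ℝ f x (EuclideanSpace.single i 1)

/-- The Euclidean metric `gᵢⱼ = δᵢⱼ` in Cartesian coordinates. -/
def euclMetric (i j : Fin 3) : ℝ := if i = j then 1 else 0

/-- The totally antisymmetric symbol `εᵢⱼₖ` with `ε₀₁₂ = 1`. -/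
def leviCivita (i j k : Fin 3) : ℝ :=
  if (i, j, k) = (0, 1, 2) ∨ (i, j, k) = (1, 2, 0) ∨ (i, j, k) = (2, 0, 1) then 1
  else if (i, j, k) = (0, 2, 1) ∨ (i, j, k) = (2, 1, 0) ∨ (i, j, k) = (1, 0, 2) then -1
  else 0

/-- The Laplacian `Δ f = Dⁿ Dₙ f`. -/
noncomputable def lapl (f : E3 → ℝ) (x : E3) : ℝ := ∑ n, pd n (pd n f) x

/-- The divergence `Dⁿ u_{jn}` of a 2-tensor field. -/
noncomputable def tensorDiv (u : E3 → Matrix (Fin 3) (Fin 3) ℝ) (j : Fin 3) (x : E3) : ℝ :=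
  ∑ n, pd n (fun y => u y j n) x

/-- The double divergence `Dⁿ Dᵏ u_{nk}` of a 2-tensor field. -/
noncomputable def tensorDivDiv (u : E3 → Matrix (Fin 3) (Fin 3) ℝ) (x : E3) : ℝ :=
  ∑ n, pd n (tensorDiv u n) x

/-- The tensor `Δ u_{jl} - 2 ∂_{(l} Dⁿ u_{j)n} + ½ g_{jl} Dⁿ Dᵏ u_{nk}`, where round brackets
denote symmetrisation with weight one half. -/
noncomputable def potentialTensor (u : E3 → Matrix (Fin 3) (Fin 3) ℝ) (j l : Fin 3) (x : E3) : ℝ :=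
  lapl (fun y => u y j l) x
    - 2 * ((1 / 2) * (pd l (tensorDiv u j) x + pd j (tensorDiv u l) x))
    + (1 / 2) * euclMetric j l * tensorDivDiv u x

/-- The third order operator
`P(u)_{ml} = ½ ε_m^{ij} ∂ᵢ (Δ u_{jl} - 2 ∂_{(l} Dⁿ u_{j)n} + ½ g_{jl} Dⁿ Dᵏ u_{nk})`. -/
noncomputable def operatorP (u : E3 → Matrix (Fin 3) (Fin 3) ℝ) (x : E3) :
    Matrix (Fin 3) (Fin 3) ℝ :=
  Matrix.of fun m l =>
    (1 / 2) * ∑ i, ∑ j, leviCivita m i j * pd i (potentialTensor u j l) x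

/-- The conformal Killing operator `Dᵢ λⱼ + Dⱼ λᵢ - (2/3) Dᵏ λₖ gᵢⱼ`. -/
noncomputable def conformalKilling (lam : E3 → Fin 3 → ℝ) (x : E3) :
    Matrix (Fin 3) (Fin 3) ℝ :=
  Matrix.of fun i j =>
    pd i (fun y => lam y j) x + pd j (fun y => lam y i) x
      - (2 / 3) * (∑ k, pd k (fun y => lam y k) x) * euclMetric i j

/-! Up to the factor `-1/2`, `potentialTensor u` is the linearised Schouten tensor `S` of the
trace-free `u`, and `P(u) = 0` is the Codazzi equation for `S`. Two applications of the Poincaré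
lemma give `S = Hess φ` (`exists_hessian_eq`). Passing to `u - φ g` is a linearised conformal change
that cancels the Schouten tensor, and in dimension three this cancels all linearised curvature
(`linearised_riemann_eq_zero`). Such a tensor is a Killing operator applied to some `λ`
(`exists_killing_eq_of_linearised_riemann_eq_zero`); taking traces gives `φ = -(2/3) div λ`. -/

/-! ### Gluing and the Poincaré lemma on simply connected sets. -/

open Filter Topology Bundle in
/-- On a simply connected, locally path-connected space, functions that are given locally and agree
up to locally constant functions on overlaps can be glued up to locally constant functions. -/
theorem exists_glue_of_sub_locallyConstant {X A : Type*} [TopologicalSpace X]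
    [SimplyConnectedSpace X] [LocallyPathConnectedSpace X] [AddCommGroup A]
    (U : X → Set X) (hU : ∀ i, IsOpen (U i)) (hmem : ∀ x, x ∈ U x) (f : X → X → A)
    (hf : ∀ i j, ∀ x ∈ U i ∩ U j, ∀ᶠ y in 𝓝 x, f i y - f j y = f i x - f j x) :
    ∃ g : X → A, ∀ i, ∀ x ∈ U i, ∀ᶠ y in 𝓝 x, g y - f i y = g x - f i x := by
  -- With discrete fibres the bundle is a covering, and continuity into `A` means local constancy.
  let _ : TopologicalSpace A := ⊥
  have : DiscreteTopology A := ⟨rfl⟩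
  let Z : FiberBundleCore X X A :=
    { baseSet := U
      isOpen_baseSet := hU
      indexAt := id
      mem_baseSet_at := hmem
      -- In chart `i` a section stands for `g - f i`, so charts differ by the translation `f i - f
      -- j`.
      coordChange := fun i j x v => v + (f i x - f j x)
      coordChange_self := fun i x _ v => by simp
      continuousOn_coordChange := fun i j => by
        rintro ⟨x, v⟩ ⟨hx, -⟩
        have hc : ContinuousAt (fun p : X × A => f i p.1 - f j p.1) (x, v) := by
          refine (continuousAt_const (y := f i x - f j x)).congr ?_
          filter_upwards [continuousAt_fst.eventually (hf i j x hx)] with p hp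
          exact hp.symm
        have hadd : Continuous (fun q : A × A => q.1 + q.2) := continuous_of_discreteTopology
        exact (hadd.continuousAt.comp
          (continuousAt_snd.prodMk hc : ContinuousAt
            (fun p : X × A => (p.2, f i p.1 - f j p.1)) (x, v))).continuousWithinAt
      coordChange_comp := fun i j k x _ v => by abel }
  have hcov : IsCoveringMap (π A Z.Fiber) := FiberBundle.isCoveringMap
  obtain ⟨x₀⟩ : Nonempty X := inferInstance
  -- Simple connectedness lifts the identity of `X` to the covering: a global section.
  obtain ⟨s, ⟨-, hs⟩, -⟩ := hcov.existsUnique_continuousMap_lifts (ContinuousMap.id X)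
    (a₀ := x₀) (e₀ := (⟨x₀, (0 : A)⟩ : TotalSpace A Z.Fiber)) rfl
  have hs' : ∀ x, (s x).1 = x := fun x => congrFun hs x
  let val : TotalSpace A Z.Fiber → A := fun p => p.2
  refine ⟨fun x => val (s x) + f x x, fun i x hx => ?_⟩
  have hmemsrc : s x ∈ (Z.localTriv i).source := by
    change (s x).1 ∈ U i
    rwa [hs' x]
  have hcont : ContinuousAt (fun y => (Z.localTriv i (s y)).2) x :=
    continuousAt_snd.comp (((Z.localTriv i).continuousAt hmemsrc).comp s.continuous.continuousAt)
  have hval : ∀ y, (Z.localTriv i (s y)).2 = val (s y) + f y y - f i y := by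
    intro y
    change val (s y) + (f (s y).1 (s y).1 - f i (s y).1) = _
    rw [hs' y]
    abel
  have := hcont.eventually (IsOpen.mem_nhds (isOpen_discrete {(Z.localTriv i (s x)).2}) rfl)
  filter_upwards [this] with y hy
  rw [← hval, ← hval]
  exact hy

open Filter Topology in
/-- Poincaré lemma: a closed `1`-form on a simply connected open set is exact. -/
theorem IsSimplyConnected.exists_forall_hasFDerivAt_of_fderiv_symmetric {E F : Type*}
    [NormedAddCommGroup E] [NormedSpace ℝ E] [NormedAddCommGroup F] [NormedSpace ℝ F]
    [CompleteSpace F] {s : Set E} (hsc : IsSimplyConnected s) (hso : IsOpen s)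
    {ω : E → E →L[ℝ] F} (hω : DifferentiableOn ℝ ω s)
    (hdω : ∀ a ∈ s, ∀ x y, fderiv ℝ ω a x y = fderiv ℝ ω a y x) :
    ∃ f, ∀ a ∈ s, HasFDerivAt f (ω a) a := by
  classical
  have := hsc.simplyConnectedSpace
  have := hso.locallyPathConnectedSpace
  have hloc : ∀ x : s, ∃ r > 0, Metric.ball (x : E) r ⊆ s := fun x =>
    Metric.isOpen_iff.1 hso x x.2
  choose r hr hrs using hloc
  have hprim : ∀ x : s, ∃ f : E → F, ∀ a ∈ Metric.ball (x : E) (r x), HasFDerivAt f (ω a) a :=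
    fun x => (convex_ball (x : E) (r x)).exists_forall_hasFDerivAt_of_fderiv_symmetric
      Metric.isOpen_ball (hω.mono (hrs x)) fun a ha => hdω a (hrs x ha)
  choose f hf using hprim
  obtain ⟨g, hg⟩ := exists_glue_of_sub_locallyConstant
    (fun i : s => {x : s | (x : E) ∈ Metric.ball (i : E) (r i)})
    (fun i => Metric.isOpen_ball.preimage continuous_subtype_val)
    (fun i => Metric.mem_ball_self (hr i)) (fun i x => f i (x : E)) (by
      rintro i j x ⟨hxi, hxj⟩
      have hV : IsOpen (Metric.ball (i : E) (r i) ∩ Metric.ball (j : E) (r j)) :=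
        Metric.isOpen_ball.inter Metric.isOpen_ball
      have hconv := (convex_ball (i : E) (r i)).inter (convex_ball (j : E) (r j))
      have hd : ∀ y ∈ Metric.ball (i : E) (r i) ∩ Metric.ball (j : E) (r j),
          HasFDerivAt (fun y => f i y - f j y) (0 : E →L[ℝ] F) y := fun y hy => by
        have h := (hf i y hy.1).sub (hf j y hy.2)
        rw [sub_self] at h
        exact h
      obtain ⟨c, hc⟩ := hV.exists_is_const_of_fderiv_eq_zero hconv.isPreconnected
        (fun y hy => (hd y hy).differentiableAt.differentiableWithinAt)
        (fun y hy => (hd y hy).fderiv)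
      filter_upwards [continuous_subtype_val.continuousAt.eventually
        (hV.mem_nhds ⟨hxi, hxj⟩)] with y hy
      rw [hc _ hy, hc _ ⟨hxi, hxj⟩])
  refine ⟨fun x => if h : x ∈ s then g ⟨x, h⟩ else 0, fun a ha => ?_⟩
  have h1 := hg ⟨a, ha⟩ ⟨a, ha⟩ (Metric.mem_ball_self (hr _))
  rw [nhds_subtype_eq_comap, eventually_comap] at h1
  refine ((hf ⟨a, ha⟩ a (Metric.mem_ball_self (hr _))).add_const
    (g ⟨a, ha⟩ - f ⟨a, ha⟩ a)).congr_of_eventuallyEq ?_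
  filter_upwards [h1, hso.mem_nhds ha] with y hy hys
  have := hy ⟨y, hys⟩ rfl
  rw [dif_pos hys, ← this]
  abel

/-! ### Calculus of Cartesian partial derivatives. -/

theorem pd_add {i : Fin 3} {f g : E3 → ℝ} {x : E3} (hf : DifferentiableAt ℝ f x)
    (hg : DifferentiableAt ℝ g x) : pd i (fun y => f y + g y) x = pd i f x + pd i g x := by
  simp [pd, fderiv_fun_add hf hg]

theorem pd_sub {i : Fin 3} {f g : E3 → ℝ} {x : E3} (hf : DifferentiableAt ℝ f x)
    (hg : DifferentiableAt ℝ g x) : pd i (fun y => f y - g y) x = pd i f x - pd i g x := by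
  simp [pd, fderiv_fun_sub hf hg]

theorem pd_const_mul {i : Fin 3} {f : E3 → ℝ} {x : E3} (c : ℝ) (hf : DifferentiableAt ℝ f x) :
    pd i (fun y => c * f y) x = c * pd i f x := by
  simp [pd, fderiv_const_mul hf c]

theorem pd_sum {ι : Type*} [Fintype ι] {i : Fin 3} {f : ι → E3 → ℝ} {x : E3}
    (hf : ∀ n, DifferentiableAt ℝ (f n) x) :
    pd i (fun y => ∑ n, f n y) x = ∑ n, pd i (f n) x := by
  simp [pd, fderiv_fun_sum (fun n _ => hf n)]

open Topology in
theorem pd_congr {Ω : Set E3} (hΩ : IsOpen Ω) {f g : E3 → ℝ} (h : ∀ x ∈ Ω, f x = g x)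
    (i : Fin 3) {x : E3} (hx : x ∈ Ω) : pd i f x = pd i g x := by
  have : f =ᶠ[𝓝 x] g := by
    filter_upwards [hΩ.mem_nhds hx] with y hy using h y hy
  simp [pd, this.fderiv_eq]

theorem fderiv_apply_eq_sum_pd (f : E3 → ℝ) (x v : E3) :
    fderiv ℝ f x v = ∑ i, v i * pd i f x := by
  have hv : v = ∑ i, v i • EuclideanSpace.single i (1 : ℝ) := by
    ext j
    fin_cases j <;> simp [Fin.sum_univ_three]
  conv_lhs => rw [hv]
  simp [map_sum, pd]

/-- Counting regularity in `ℕ∞`, where `∞ + 1 = ∞`, treats the finite and smooth cases together. -/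
theorem contDiffOn_pd {Ω : Set E3} (hΩ : IsOpen Ω) {n : ℕ∞} {f : E3 → ℝ}
    (hf : ContDiffOn ℝ ((n + 1 : ℕ∞) : WithTop ℕ∞) f Ω) (i : Fin 3) :
    ContDiffOn ℝ (n : WithTop ℕ∞) (pd i f) Ω :=
  (hf.fderiv_of_isOpen hΩ (by push_cast; exact le_rfl)).clm_apply contDiffOn_const

theorem pd_comm {Ω : Set E3} (hΩ : IsOpen Ω) {f : E3 → ℝ} (hf : ContDiffOn ℝ 2 f Ω)
    (i j : Fin 3) {x : E3} (hx : x ∈ Ω) : pd i (pd j f) x = pd j (pd i f) x := by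
  have hfx : ContDiffAt ℝ 2 f x := hf.contDiffAt (hΩ.mem_nhds hx)
  have hd : DifferentiableAt ℝ (fderiv ℝ f) x :=
    (hfx.fderiv_right (m := 1) (by norm_num)).differentiableAt (by norm_num)
  have key : ∀ a b : Fin 3, pd a (pd b f) x =
      fderiv ℝ (fderiv ℝ f) x (EuclideanSpace.single a 1) (EuclideanSpace.single b 1) := by
    intro a b
    change fderiv ℝ (fun y => fderiv ℝ f y (EuclideanSpace.single b 1)) x _ = _
    rw [fderiv_clm_apply hd (differentiableAt_const _)]
    simp
  rw [key, key]
  exact (hfx.isSymmSndFDerivAt (by simp)) _ _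

/-- On a simply connected open set, a curl-free covector field of class `C^n`, `1 ≤ n`, is the
gradient of a function of class `C^(n+1)`. -/
theorem exists_contDiffOn_pd_eq {Ω : Set E3} (hΩ : IsOpen Ω) (hsc : IsSimplyConnected Ω)
    {n : ℕ∞} (hn : 1 ≤ n) {a : Fin 3 → E3 → ℝ}
    (ha : ∀ i, ContDiffOn ℝ (n : WithTop ℕ∞) (a i) Ω)
    (hcl : ∀ i j, ∀ x ∈ Ω, pd i (a j) x = pd j (a i) x) :
    ∃ f : E3 → ℝ, ContDiffOn ℝ ((n + 1 : ℕ∞) : WithTop ℕ∞) f Ω ∧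
      ∀ i, ∀ x ∈ Ω, pd i f x = a i x := by
  have hn' : (n : WithTop ℕ∞) ≠ 0 := by
    exact_mod_cast (zero_lt_one.trans_le hn).ne'
  let ω : E3 → E3 →L[ℝ] ℝ := fun x => ∑ i, a i x • EuclideanSpace.proj (𝕜 := ℝ) i
  have hω : ContDiffOn ℝ (n : WithTop ℕ∞) ω Ω :=
    ContDiffOn.sum fun i _ => (ha i).smul contDiffOn_const
  have hda : ∀ i, ∀ x ∈ Ω, DifferentiableAt ℝ (a i) x := fun i x hx =>
    ((ha i).differentiableOn hn').differentiableAt (hΩ.mem_nhds hx)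
  have hdω : ∀ x ∈ Ω, ∀ v w, fderiv ℝ ω x v w = ∑ i, ∑ j, v j * pd j (a i) x * w i := by
    intro x hx v w
    have h : HasFDerivAt ω (∑ i, (fderiv ℝ (a i) x).smulRight
        (EuclideanSpace.proj (𝕜 := ℝ) i : E3 →L[ℝ] ℝ)) x :=
      HasFDerivAt.fun_sum fun i _ => by
        have h := (hda i x hx).hasFDerivAt.smul_const (EuclideanSpace.proj (𝕜 := ℝ) i : E3 →L[ℝ] ℝ)
        exact h
    rw [h.fderiv]
    simp [fderiv_apply_eq_sum_pd, Finset.sum_mul]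
  obtain ⟨f, hf⟩ := hsc.exists_forall_hasFDerivAt_of_fderiv_symmetric hΩ
    (hω.differentiableOn hn') (fun x hx v w => by
      rw [hdω x hx, hdω x hx, Finset.sum_comm]
      refine Finset.sum_congr rfl fun i _ => Finset.sum_congr rfl fun j _ => ?_
      rw [hcl i j x hx]
      ring)
  refine ⟨f, ?_, fun i x hx => ?_⟩
  · push_cast
    rw [contDiffOn_succ_iff_fderiv_of_isOpen hΩ]
    refine ⟨fun x hx => (hf x hx).differentiableAt.differentiableWithinAt, by simp, ?_⟩
    exact hω.congr fun x hx => (hf x hx).fderiv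
  · simp only [pd, (hf x hx).fderiv, ω]
    fin_cases i <;> simp [Fin.sum_univ_three]

/-! ### Linearised curvature and the Killing operator. -/

/-- If the linearised Schouten tensor of the algebraic data of a symmetric trace-free tensor `u` is
minus half the Hessian `H` of a function `φ`, then the linearised Riemann tensor of `u - φ g`
vanishes. Here `D a b i j` stands for `∂ₐ ∂_b uᵢⱼ`. -/
theorem linearised_riemann_eq_zero {D : Fin 3 → Fin 3 → Fin 3 → Fin 3 → ℝ}
    {H : Fin 3 → Fin 3 → ℝ} (hD₁ : ∀ a b i j, D a b i j = D b a i j)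
    (hD₂ : ∀ a b i j, D a b i j = D a b j i)
    (htr : ∀ a b, D a b 0 0 + D a b 1 1 + D a b 2 2 = 0)
    (hH : ∀ j l, H j l = ∑ n, D n n j l - (∑ n, D l n j n + ∑ n, D j n l n)
      + 1 / 2 * euclMetric j l * ∑ n, ∑ m, D n m n m) (k l i j : Fin 3) :
    (D l i k j - euclMetric k j * H l i) - (D l j k i - euclMetric k i * H l j)
      = (D k i l j - euclMetric l j * H k i) - (D k j l i - euclMetric l i * H k j) := by
  simp only [hH, Fin.sum_univ_three]
  -- Sorting both index pairs and eliminating the `22` component leaves independent unknowns, so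
  -- each component is a linear identity.
  have a1 := hD₁ 1 0
  have a2 := hD₁ 2 0
  have a3 := hD₁ 2 1
  have b1 := fun a b => hD₂ a b 1 0
  have b2 := fun a b => hD₂ a b 2 0
  have b3 := fun a b => hD₂ a b 2 1
  have c : ∀ a b, D a b 2 2 = - D a b 0 0 - D a b 1 1 := fun a b => by linarith [htr a b]
  fin_cases k <;> fin_cases l <;> fin_cases i <;> fin_cases j <;>
    simp [euclMetric, a1, a2, a3, b1, b2, b3, c] <;> ring

/-- A symmetric tensor field of class `C^(m+2)` with vanishing linearised Riemann tensor on a simply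
connected open set is the Killing operator applied to a covector field of class `C^(m+3)`. -/
theorem exists_killing_eq_of_linearised_riemann_eq_zero {Ω : Set E3} (hΩ : IsOpen Ω)
    (hsc : IsSimplyConnected Ω) {m : ℕ∞} {h : Fin 3 → Fin 3 → E3 → ℝ}
    (hh : ∀ i j, ContDiffOn ℝ ((m + 1 + 1 : ℕ∞) : WithTop ℕ∞) (h i j) Ω)
    (hsymm : ∀ i j, ∀ x ∈ Ω, h i j x = h j i x)
    (hR : ∀ k l i j, ∀ x ∈ Ω, pd l (pd i (h k j)) x - pd l (pd j (h k i)) x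
      = pd k (pd i (h l j)) x - pd k (pd j (h l i)) x) :
    ∃ lam : Fin 3 → E3 → ℝ,
      (∀ i, ContDiffOn ℝ ((m + 1 + 1 + 1 : ℕ∞) : WithTop ℕ∞) (lam i) Ω) ∧
        ∀ i j, ∀ x ∈ Ω, pd i (lam j) x + pd j (lam i) x = h i j x := by
  have diff : ∀ {n : ℕ∞} {f : E3 → ℝ}, ContDiffOn ℝ (n : WithTop ℕ∞) f Ω → 1 ≤ n →
      ∀ x ∈ Ω, DifferentiableAt ℝ f x := fun hf hn x hx =>
    (hf.differentiableOn (by exact_mod_cast (zero_lt_one.trans_le hn).ne')).differentiableAt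
      (hΩ.mem_nhds hx)
  have hdh : ∀ a i j, ContDiffOn ℝ ((m + 1 : ℕ∞) : WithTop ℕ∞) (pd a (h i j)) Ω :=
    fun a i j => contDiffOn_pd hΩ (hh i j) a
  -- `F i j` plays the role of `∂ᵢλⱼ - ∂ⱼλᵢ`, whose gradient is forced by `h`; closedness is `hR`.
  have hF : ∀ i j, ∃ F : E3 → ℝ, ContDiffOn ℝ ((m + 1 + 1 : ℕ∞) : WithTop ℕ∞) F Ω ∧
      ∀ k, ∀ x ∈ Ω, pd k F x = pd i (h k j) x - pd j (h k i) x := fun i j =>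
    exists_contDiffOn_pd_eq (a := fun k x => pd i (h k j) x - pd j (h k i) x) hΩ hsc le_add_self
      (fun k => (hdh i k j).sub (hdh j k i)) fun k l x hx => by
        have d : ∀ a i j, DifferentiableAt ℝ (pd a (h i j)) x := fun a i j =>
          diff (hdh a i j) le_add_self x hx
        rw [pd_sub (d _ _ _) (d _ _ _), pd_sub (d _ _ _) (d _ _ _)]
        exact hR l k i j x hx
  choose F hFc hFd using hF
  -- `∂ₖλⱼ` is half of `h k j` plus the rotation. Each `F i j` has its own additive constant, so `F`
  -- is antisymmetrised by hand.
  have hL : ∀ j, ∃ L : E3 → ℝ, ContDiffOn ℝ ((m + 1 + 1 + 1 : ℕ∞) : WithTop ℕ∞) L Ω ∧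
      ∀ k, ∀ x ∈ Ω, pd k L x = 1 / 2 * (h k j x + 1 / 2 * (F k j x - F j k x)) := fun j =>
    exists_contDiffOn_pd_eq (a := fun k x => 1 / 2 * (h k j x + 1 / 2 * (F k j x - F j k x)))
      hΩ hsc le_add_self
      (fun k => contDiffOn_const.mul ((hh k j).add (contDiffOn_const.mul
        ((hFc k j).sub (hFc j k))))) fun k l x hx => by
        have dh : ∀ i j, DifferentiableAt ℝ (h i j) x := fun i j =>
          diff (hh i j) le_add_self x hx
        have dF : ∀ i j, DifferentiableAt ℝ (F i j) x := fun i j =>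
          diff (hFc i j) le_add_self x hx
        -- The bracket is a linearised Christoffel symbol, symmetric in `k` and `l` because `h` is
        -- symmetric.
        have e : ∀ k l, pd k (fun x => 1 / 2 * (h l j x + 1 / 2 * (F l j x - F j l x))) x
            = 1 / 2 * (pd k (h l j) x + (pd l (h k j) x - pd j (h k l) x)) := fun k l => by
          have dA : DifferentiableAt ℝ (fun y => F l j y - F j l y) x := (dF _ _).sub (dF _ _)
          have dB : DifferentiableAt ℝ (fun y => 1 / 2 * (F l j y - F j l y)) x := dA.const_mul _
          have dC : DifferentiableAt ℝ (fun y => h l j y + 1 / 2 * (F l j y - F j l y)) x :=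
            (dh _ _).add dB
          rw [pd_const_mul _ dC, pd_add (dh _ _) dB,
            pd_const_mul _ dA, pd_sub (dF _ _) (dF _ _),
            hFd _ _ _ x hx, hFd _ _ _ x hx]
          ring
        rw [e, e, pd_congr hΩ (hsymm k l) j hx]
        ring
  choose L hLc hLd using hL
  refine ⟨L, hLc, fun i j x hx => ?_⟩
  rw [hLd j i x hx, hLd i j x hx, hsymm j i x hx]
  ring

/-- The curl of a covector field vanishes only if its first partial derivatives commute. -/
theorem pd_eq_of_curl_eq_zero {S : Fin 3 → E3 → ℝ} {x : E3}
    (h : ∀ m, (1 / 2) * ∑ i, ∑ j, leviCivita m i j * pd i (S j) x = 0) (i j : Fin 3) :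
    pd i (S j) x = pd j (S i) x := by
  have h0 := h 0
  have h1 := h 1
  have h2 := h 2
  simp [Fin.sum_univ_three, leviCivita] at h0 h1 h2
  fin_cases i <;> fin_cases j <;> simp <;> linarith

/-- On a simply connected open set, a symmetric tensor field satisfying the Codazzi equation is the
Hessian of a function. -/
theorem exists_hessian_eq {Ω : Set E3} (hΩ : IsOpen Ω) (hsc : IsSimplyConnected Ω)
    {m : ℕ∞} (hm : 1 ≤ m) {S : Fin 3 → Fin 3 → E3 → ℝ}
    (hS : ∀ i j, ContDiffOn ℝ (m : WithTop ℕ∞) (S i j) Ω)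
    (hsymm : ∀ i j, ∀ x ∈ Ω, S i j x = S j i x)
    (hcod : ∀ i j l, ∀ x ∈ Ω, pd i (S j l) x = pd j (S i l) x) :
    ∃ φ : E3 → ℝ, ContDiffOn ℝ ((m + 1 + 1 : ℕ∞) : WithTop ℕ∞) φ Ω ∧
      ∀ i j, ∀ x ∈ Ω, pd i (pd j φ) x = S i j x := by
  have hw := fun l => exists_contDiffOn_pd_eq (a := fun j => S j l) hΩ hsc hm
    (fun j => hS j l) (fun i j => hcod i j l)
  choose w hwc hwd using hw
  obtain ⟨φ, hφc, hφd⟩ := exists_contDiffOn_pd_eq hΩ hsc le_add_self hwc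
    (fun i j x hx => by rw [hwd j i x hx, hwd i j x hx, hsymm i j x hx])
  exact ⟨φ, hφc, fun i j x hx => by rw [pd_congr hΩ (hφd j) i hx, hwd j i x hx]⟩

/-! ### The image of the conformal Killing operator. -/

theorem mainTheorem6 (Ω : Set E3) (hΩ : IsOpen Ω) (hsc : IsSimplyConnected Ω)
    (k : ℕ∞) (hk : 3 ≤ k)
    (u : E3 → Matrix (Fin 3) (Fin 3) ℝ)
    (hu : ∀ i j, ContDiffOn ℝ (k : WithTop ℕ∞) (fun x => u x i j) Ω)
    (hsymm : ∀ x ∈ Ω, (u x).IsSymm)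
    (htr : ∀ x ∈ Ω, (u x).trace = 0)
    (hP : ∀ x ∈ Ω, operatorP u x = 0) :
    ∃ lam : E3 → Fin 3 → ℝ,
      (∀ i, ContDiffOn ℝ ((k + 1 : ℕ∞) : WithTop ℕ∞) (fun x => lam x i) Ω) ∧
        ∀ x ∈ Ω, u x = conformalKilling lam x := by
  -- `S` has class `C^m` with `m = k - 2`; `1 ≤ m` lets the Poincaré lemma apply to it.
  obtain ⟨m, hm, rfl⟩ : ∃ m : ℕ∞, 1 ≤ m ∧ k = m + 1 + 1 := by
    obtain ⟨p, rfl⟩ := exists_add_of_le hk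
    refine ⟨1 + p, le_self_add, ?_⟩
    rw [show (3 : ℕ∞) = 1 + 1 + 1 from by norm_num]
    ring
  have diff : ∀ {n : ℕ∞} {f : E3 → ℝ}, ContDiffOn ℝ (n : WithTop ℕ∞) f Ω → 1 ≤ n →
      ∀ x ∈ Ω, DifferentiableAt ℝ f x := fun hf hn x hx =>
    (hf.differentiableOn (by exact_mod_cast (zero_lt_one.trans_le hn).ne')).differentiableAt
      (hΩ.mem_nhds hx)
  have two_le : ((2 : ℕ∞) : WithTop ℕ∞) ≤ ((m + 1 + 1 : ℕ∞) : WithTop ℕ∞) := by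
    have : (2 : ℕ∞) ≤ m + 1 + 1 := by
      rw [add_assoc, one_add_one_eq_two]
      exact le_add_self
    exact WithTop.coe_le_coe.2 this
  have hus : ∀ i j, ∀ x ∈ Ω, u x i j = u x j i := fun i j x hx => (hsymm x hx).apply j i
  have hdu : ∀ a i j, ContDiffOn ℝ ((m + 1 : ℕ∞) : WithTop ℕ∞) (pd a fun x => u x i j) Ω :=
    fun a i j => contDiffOn_pd hΩ (hu i j) a
  have hddu : ∀ b a i j, ContDiffOn ℝ (m : WithTop ℕ∞) (pd b (pd a fun x => u x i j)) Ω :=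
    fun b a i j => contDiffOn_pd hΩ (hdu a i j) b
  -- second derivatives of `u`, and the potential tensor in terms of them
  have hdiv : ∀ a j, ∀ x ∈ Ω, pd a (tensorDiv u j) x = ∑ n, pd a (pd n fun y => u y j n) x :=
    fun a j x hx => pd_sum fun n => diff (hdu n j n) le_add_self x hx
  have hdivdiv : ∀ x ∈ Ω, tensorDivDiv u x = ∑ n, ∑ p, pd n (pd p fun y => u y n p) x :=
    fun x hx => Finset.sum_congr rfl fun n _ => hdiv n n x hx
  have hpot : ∀ j l, ∀ x ∈ Ω, potentialTensor u j l x
      = ∑ n, pd n (pd n fun y => u y j l) x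
        - (∑ n, pd l (pd n fun y => u y j n) x + ∑ n, pd j (pd n fun y => u y l n) x)
        + 1 / 2 * euclMetric j l * ∑ n, ∑ p, pd n (pd p fun y => u y n p) x := by
    intro j l x hx
    rw [potentialTensor, lapl, hdiv l j x hx, hdiv j l x hx, hdivdiv x hx]
    ring
  have hpc : ∀ j l, ContDiffOn ℝ (m : WithTop ℕ∞) (potentialTensor u j l) Ω := by
    intro j l
    refine ContDiffOn.congr ?_ (hpot j l)
    exact ((ContDiffOn.sum fun n _ => hddu n n j l).sub
      ((ContDiffOn.sum fun n _ => hddu l n j n).add (ContDiffOn.sum fun n _ => hddu j n l n))).add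
      (contDiffOn_const.mul (ContDiffOn.sum fun n _ => ContDiffOn.sum fun p _ => hddu n p n p))
  have hD₂ : ∀ a b i j, ∀ x ∈ Ω,
      pd a (pd b fun y => u y i j) x = pd a (pd b fun y => u y j i) x := fun a b i j x hx =>
    pd_congr hΩ (fun y hy => pd_congr hΩ (hus i j) b hy) a hx
  have hD₁ : ∀ a b i j, ∀ x ∈ Ω,
      pd a (pd b fun y => u y i j) x = pd b (pd a fun y => u y i j) x := fun a b i j x hx =>
    pd_comm hΩ ((hu i j).of_le two_le) a b hx
  have hDtr : ∀ a b, ∀ x ∈ Ω, pd a (pd b fun y => u y 0 0) x + pd a (pd b fun y => u y 1 1) x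
      + pd a (pd b fun y => u y 2 2) x = 0 := by
    intro a b x hx
    have e1 : ∀ y ∈ Ω, ∑ i, pd b (fun y => u y i i) y = 0 := fun y hy => by
      have htr' : ∀ y ∈ Ω, ∑ i, u y i i = 0 := htr
      rw [← pd_sum fun i => diff (hu i i) le_add_self y hy, pd_congr hΩ (g := fun _ => 0) htr' b hy]
      simp [pd]
    have e2 : ∑ i, pd a (pd b fun y => u y i i) x = 0 := by
      rw [← pd_sum fun i => diff (hdu b i i) le_add_self x hx, pd_congr hΩ (g := fun _ => 0) e1 a hx]
      simp [pd]
    rwa [Fin.sum_univ_three] at e2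
  -- Two integrations recover the two derivatives lost in `S`, so `φ` is as regular as `u`.
  obtain ⟨φ, hφc, hφd⟩ := exists_hessian_eq hΩ hsc hm hpc
    (fun i j x hx => by
      rw [potentialTensor, potentialTensor, lapl, lapl]
      simp_rw [fun n => hD₂ n n i j x hx]
      simp only [euclMetric, eq_comm (a := i)]
      ring)
    (fun i j l x hx => pd_eq_of_curl_eq_zero (S := fun j => potentialTensor u j l)
      (fun p => congrFun (congrFun (hP x hx) p) l) i j)
  have hdφ : ∀ a, ContDiffOn ℝ ((m + 1 : ℕ∞) : WithTop ℕ∞) (pd a φ) Ω := contDiffOn_pd hΩ hφc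
  have hpdh : ∀ l i p j, ∀ x ∈ Ω, pd l (pd i fun x => u x p j - euclMetric p j * φ x) x
      = pd l (pd i fun x => u x p j) x - euclMetric p j * potentialTensor u l i x := by
    intro l i p j x hx
    rw [pd_congr hΩ (g := fun y => pd i (fun x => u x p j) y - euclMetric p j * pd i φ y)
        (fun y hy => ?_) l hx,
      pd_sub (diff (hdu i p j) le_add_self x hx) ((diff (hdφ i) le_add_self x hx).const_mul _),
      pd_const_mul _ (diff (hdφ i) le_add_self x hx), hφd l i x hx]
    rw [pd_sub (diff (hu p j) le_add_self y hy) ((diff hφc le_add_self y hy).const_mul _),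
      pd_const_mul _ (diff hφc le_add_self y hy)]
  obtain ⟨L, hLc, hLd⟩ := exists_killing_eq_of_linearised_riemann_eq_zero hΩ hsc
    (h := fun i j x => u x i j - euclMetric i j * φ x)
    (fun i j => (hu i j).sub (contDiffOn_const.mul hφc))
    (fun i j x hx => by rw [hus i j x hx, euclMetric, euclMetric]; simp only [eq_comm (a := i)])
    (fun p l i j x hx => by
      rw [hpdh _ _ _ _ x hx, hpdh _ _ _ _ x hx, hpdh _ _ _ _ x hx, hpdh _ _ _ _ x hx]
      exact linearised_riemann_eq_zero (D := fun a b i j => pd a (pd b fun y => u y i j) x)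
        (H := fun i j => potentialTensor u i j x) (fun a b i j => hD₁ a b i j x hx)
        (fun a b i j => hD₂ a b i j x hx) (fun a b => hDtr a b x hx)
        (fun j l => hpot j l x hx) p l i j)
  refine ⟨fun x i => L i x, hLc, fun x hx => ?_⟩
  -- Since `u` is trace-free, the trace of `u - φ g` is `-3φ`, and it equals `2 div L`.
  have htrL : ∑ p, pd p (L p) x = - (3 / 2) * φ x := by
    have e : ∀ p, pd p (L p) x = 1 / 2 * (u x p p - φ x) := fun p => by
      have := hLd p p x hx
      simp only [euclMetric, if_true] at this
      linarith
    have t : u x 0 0 + u x 1 1 + u x 2 2 = 0 := by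
      simpa [Matrix.trace, Fin.sum_univ_three] using htr x hx
    rw [Fin.sum_univ_three, e, e, e]
    linarith
  ext i j
  change u x i j = pd i (L j) x + pd j (L i) x - 2 / 3 * (∑ p, pd p (L p) x) * euclMetric i j
  rw [hLd i j x hx, htrL]
  ring
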